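/- For $a,m\in\mathbb R$, $b>0$, $\rho\in[-1,1]$, $\sigma>0$ let \[SVI(k)=a+b\bigl(\rho(k-m)+\sqrt{(k-m)^2+\sigma^2}\bigr),\qquad k\in\mathbb R,\] and $\mu=m/\sigma$. A total implied variance smile $w:\mathbb R\to[0,\infty)$ is called free of Butterfly arbitrage if the Call price curve $C(\kappa)=C_{BS}(\kappa,\sqrt{w(\log\kappa)})$ (with $C(0)=1$) is convex on $[0,\infty)$ and satisfies $(1-\kappa)^+\le C(\kappa)\le 1$ for every $\kappa\ge 0$. Here $C_{BS}(\kappa,s)=\Phi\bigl(-\tfrac{\log\kappa}{s}+\tfrac s2\bigr)-\kappa\,\Phi\bigl(-\tfrac{\log\kappa}{s}-\tfrac s2\bigr)$ for $\kappa,s>0$, $C_{BS}(\kappa,0)=(1-\kappa)^+$, and $\Phi$ is the standard normal distribution function. The Vanishing Upward SVI is the case $a=0$, $\rho=1$, that is $SVI(k)=b\bigl(k-m+\sqrt{(k-m)^2+\sigma^2}\bigr)$. For $0<b<1$ and $\frac{2+b}{4-b}<x<1$ define \[\mu^*(x)=\frac{2(1-x)(2x^2-8x-1)+\sqrt{4b^2x^6+8b^2x^5+8x^4(8-b^2)-4x^3(5b^2+32)+x^2(96-b^2)+2x(5b^2-16)+4+3b^2}}{2\sqrt{1-x^2}\,(2x^2-2x-1)},\]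 \[\sigma^*(x)=-\frac{4b\sqrt{1-x^2}\,(1-x-2x^2)}{4\bigl(2-x-\mu^*(x)\sqrt{1-x^2}\bigr)^2-b^2(1+x)^2}.\] (i) A Vanishing Upward SVI with $b=1$ and $\sigma>0$ is free of Butterfly arbitrage if and only if $\mu<0$ and $\sigma\ge-\frac1\mu$. (ii) A Vanishing Upward SVI with $0<b<1$ and $\sigma>0$ is free of Butterfly arbitrage if and only if it can be parametrized as \[SVI(k)=b\sigma\Bigl(\frac k\sigma-\mu^*(x)+\sqrt{\Bigl(\frac k\sigma-\mu^*(x)\Bigr)^2+1}\Bigr)\] (that is, $\mu=\mu^*(x)$) for some $x$ with $\frac{2+b}{4-b}<x<1$, and $\sigma\ge\sigma^*(x)$. -/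

import Mathlib

open Real Set MeasureTheory ProbabilityTheory

noncomputable section

namespace SVI

/-- The distribution function of the standard normal law. -/
def stdNormalCDF (x : ℝ) : ℝ := cdf (gaussianReal 0 1) x

/-- Normalized Black-Scholes price (unit underlying, zero rates) of a Call of strike `κ ≥ 0` when
the total implied volatility (the square root of the total implied variance) is `s ≥ 0`.
The cases `κ = 0` and `s = 0` are the usual limiting values of the formula. -/
def bsCall (κ s : ℝ) : ℝ :=
  if κ = 0 then 1
  else if s = 0 then max (1 - κ) 0
  else stdNormalCDF (-log κ / s + s / 2) - κ * stdNormalCDF (-log κ / s - s / 2)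

/-- The Call price curve, as a function of the strike `κ ≥ 0`, of the smile with total implied
variance `w k` at log-strike `k = log κ`. -/
def callCurve (w : ℝ → ℝ) (κ : ℝ) : ℝ := bsCall κ √(w (log κ))

/-- A curve of Call prices is free of Butterfly arbitrage when it is convex in the strike and
lies between `(1 - κ)⁺` and `1`; a total variance smile is free of Butterfly arbitrage when its
curve of Call prices is. -/
structure ButterflyArbitrageFree (w : ℝ → ℝ) : Prop where
  nonneg : ∀ k, 0 ≤ w k
  convex : ConvexOn ℝ (Ici 0) (callCurve w)
  lower : ∀ κ, 0 ≤ κ → max (1 - κ) 0 ≤ callCurve w κ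
  upper : ∀ κ, 0 ≤ κ → callCurve w κ ≤ 1

/-- The general SVI total variance smile. -/
def svi (a b ρ m σ : ℝ) (k : ℝ) : ℝ :=
  a + b * (ρ * (k - m) + √((k - m) ^ 2 + σ ^ 2))

/-- The Vanishing Upward SVI: `a = 0` and `ρ = 1`. -/
def vanishingUpwardSVI (b m σ : ℝ) : ℝ → ℝ := svi 0 b 1 m σ

/-- The closed-form function `μ*` (for a given `b`). -/
def muStar (b x : ℝ) : ℝ :=
  (2 * (1 - x) * (2 * x ^ 2 - 8 * x - 1)
      + √(4 * b ^ 2 * x ^ 6 + 8 * b ^ 2 * x ^ 5 + 8 * x ^ 4 * (8 - b ^ 2)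
          - 4 * x ^ 3 * (5 * b ^ 2 + 32) + x ^ 2 * (96 - b ^ 2)
          + 2 * x * (5 * b ^ 2 - 16) + 4 + 3 * b ^ 2))
    / (2 * √(1 - x ^ 2) * (2 * x ^ 2 - 2 * x - 1))

/-- The closed-form function `σ*` (for a given `b`). -/
def sigmaStar (b x : ℝ) : ℝ :=
  -(4 * b * √(1 - x ^ 2) * (1 - x - 2 * x ^ 2)
    / (4 * (2 - x - muStar b x * √(1 - x ^ 2)) ^ 2 - b ^ 2 * (1 + x) ^ 2))

end SVI

end

/-! For a positive, twice differentiable total volatility the price bounds hold automatically, so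
absence of arbitrage is convexity of the Call curve, i.e. nonnegativity of Durrleman's function
(`butterflyArbitrageFree_iff_durrleman_nonneg`). For the Vanishing Upward SVI the variable r = √(u²
+ 1) - u, u = (k - m)/σ, makes this rational: b² + (4b/σ) excess(r) ≤ q(r)² for all r > 0, where
q(r) = 1 - 2μr + 3r².

For b = 1 both sides agree at r = 0; the first-order terms give 1/σ ≤ -μ, which suffices because
excess(r) ≤ r.

For b < 1 the ratio (q² - b²)/excess has a critical point with q > b and 3r² < 1 - b, by the
intermediate value theorem. A tangent-line bound on excess makes any such point a global minimum
over excess > 0 (`le_sq_of_critical`), so only the inequality there matters. Solving the critical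
equation, quadratic in q, gives μ*; the inequality itself is σ ≥ σ*, with x = (1 - r²)/(1 + r²). -/

namespace SVI

open Filter Topology

/-! ### The standard normal law. -/

/-- The density of the standard normal law. -/
noncomputable def stdNormalPDF (x : ℝ) : ℝ := (√(2 * π))⁻¹ * exp (-(x ^ 2 / 2))

lemma stdNormalPDF_pos (x : ℝ) : 0 < stdNormalPDF x := by
  unfold stdNormalPDF; positivity

lemma gaussianPDFReal_zero_one (x : ℝ) : gaussianPDFReal 0 1 x = stdNormalPDF x := by
  simp [gaussianPDFReal, stdNormalPDF, neg_div]

lemma continuous_stdNormalPDF : Continuous stdNormalPDF := by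
  unfold stdNormalPDF; fun_prop

lemma stdNormalCDF_eq_integral (x : ℝ) : stdNormalCDF x = ∫ y in Iic x, stdNormalPDF y := by
  rw [stdNormalCDF, cdf_eq_real, measureReal_def, gaussianReal_apply_eq_integral _ one_ne_zero,
    ENNReal.toReal_ofReal (integral_nonneg fun y => gaussianPDFReal_nonneg _ _ _)]
  simp only [gaussianPDFReal_zero_one]

lemma integrable_stdNormalPDF : Integrable stdNormalPDF := by
  have h := integrable_gaussianPDFReal 0 1
  rwa [funext gaussianPDFReal_zero_one] at h

lemma hasDerivAt_stdNormalCDF (x : ℝ) : HasDerivAt stdNormalCDF (stdNormalPDF x) x := by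
  have h : stdNormalCDF = fun x => stdNormalCDF 0 + ∫ y in (0 : ℝ)..x, stdNormalPDF y := by
    funext x
    rw [stdNormalCDF_eq_integral, stdNormalCDF_eq_integral,
      ← intervalIntegral.integral_Iic_sub_Iic integrable_stdNormalPDF.integrableOn
        integrable_stdNormalPDF.integrableOn]
    ring
  rw [h]
  exact (intervalIntegral.integral_hasDerivAt_right
    (continuous_stdNormalPDF.intervalIntegrable _ _)
    (continuous_stdNormalPDF.stronglyMeasurableAtFilter _ _)
    continuous_stdNormalPDF.continuousAt).const_add _

lemma stdNormalCDF_nonneg (x : ℝ) : 0 ≤ stdNormalCDF x := cdf_nonneg _ x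

lemma stdNormalCDF_le_one (x : ℝ) : stdNormalCDF x ≤ 1 := cdf_le_one _ x

lemma tendsto_stdNormalCDF_atTop : Tendsto stdNormalCDF atTop (𝓝 1) := tendsto_cdf_atTop _

lemma tendsto_stdNormalCDF_atBot : Tendsto stdNormalCDF atBot (𝓝 0) := tendsto_cdf_atBot _

lemma stdNormalCDF_add_neg (x : ℝ) : stdNormalCDF x + stdNormalCDF (-x) = 1 := by
  have hd : ∀ x, HasDerivAt (fun x => stdNormalCDF x + stdNormalCDF (-x)) 0 x := fun x => by
    have h := (hasDerivAt_stdNormalCDF x).add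
      ((hasDerivAt_stdNormalCDF (-x)).comp x (hasDerivAt_neg x))
    have e : stdNormalPDF x + stdNormalPDF (-x) * -1 = 0 := by simp [stdNormalPDF]
    rw [e] at h
    exact h
  have hc : ∀ y, stdNormalCDF y + stdNormalCDF (-y) = stdNormalCDF x + stdNormalCDF (-x) :=
    fun y => is_const_of_deriv_eq_zero (fun x => (hd x).differentiableAt)
      (fun x => (hd x).deriv) y x
  have ht : Tendsto (fun y => stdNormalCDF y + stdNormalCDF (-y)) atTop (𝓝 (1 + 0)) :=
    tendsto_stdNormalCDF_atTop.add (tendsto_stdNormalCDF_atBot.comp tendsto_neg_atTop_atBot)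
  rw [add_zero] at ht
  simp only [hc] at ht
  exact tendsto_nhds_unique tendsto_const_nhds ht

/-- The two squared arguments differ by -2k. This identity merges the density terms when
Black-Scholes prices are differentiated. -/
lemma stdNormalPDF_add_half {s : ℝ} (hs : s ≠ 0) (k : ℝ) :
    stdNormalPDF (-k / s + s / 2) = exp k * stdNormalPDF (-k / s - s / 2) := by
  unfold stdNormalPDF
  rw [mul_left_comm, ← exp_add]
  congr 2
  field_simp
  ring

/-! ### Bounds on Black-Scholes prices. -/

/-- Monotonicity in the log-strike of the Black-Scholes Put price. -/
lemma one_sub_exp_le_blackScholes {s : ℝ} (hs : 0 < s) (k : ℝ) :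
    1 - exp k ≤ stdNormalCDF (-k / s + s / 2) - exp k * stdNormalCDF (-k / s - s / 2) := by
  let f : ℝ → ℝ := fun k =>
    stdNormalCDF (-k / s + s / 2) - exp k * stdNormalCDF (-k / s - s / 2) + exp k
  have hd : ∀ k, HasDerivAt f (exp k * (1 - stdNormalCDF (-k / s - s / 2))) k := fun k => by
    have h0 : HasDerivAt (fun k : ℝ => -k / s) (-1 / s) k := (hasDerivAt_neg k).div_const s
    have h := (((hasDerivAt_stdNormalCDF (-k / s + s / 2)).comp k (h0.add_const (s / 2))).sub
      ((hasDerivAt_exp k).mul ((hasDerivAt_stdNormalCDF (-k / s - s / 2)).comp k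
        (h0.sub_const (s / 2))))).add (hasDerivAt_exp k)
    refine h.congr_deriv ?_
    rw [stdNormalPDF_add_half hs.ne']
    simp only [Function.comp]
    ring
  have hm : Monotone f := monotone_of_hasDerivAt_nonneg hd fun k =>
    mul_nonneg (exp_pos k).le (sub_nonneg.2 (stdNormalCDF_le_one _))
  have hk : Tendsto (fun k : ℝ => -k / s) atBot atTop :=
    tendsto_neg_atBot_atTop.atTop_div_const hs
  have hl : Tendsto f atBot (𝓝 (1 - 0 * 1 + 0)) := by
    refine ((tendsto_stdNormalCDF_atTop.comp (tendsto_atTop_add_const_right _ (s / 2) hk)).sub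
      (tendsto_exp_atBot.mul (tendsto_stdNormalCDF_atTop.comp
        (tendsto_atTop_add_const_right _ (-(s / 2)) hk)))).add tendsto_exp_atBot
  have := hm.le_of_tendsto hl k
  simp only [f] at this
  linarith

/-- Put-Call symmetry: the previous bound at -k, multiplied by exp k. -/
lemma blackScholes_nonneg {s : ℝ} (hs : 0 < s) (k : ℝ) :
    0 ≤ stdNormalCDF (-k / s + s / 2) - exp k * stdNormalCDF (-k / s - s / 2) := by
  have h := one_sub_exp_le_blackScholes hs (-k)
  have h1 := stdNormalCDF_add_neg (-k / s + s / 2)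
  have h2 := stdNormalCDF_add_neg (-k / s - s / 2)
  rw [show -(-k / s + s / 2) = - -k / s - s / 2 by ring] at h1
  rw [show -(-k / s - s / 2) = - -k / s + s / 2 by ring] at h2
  have h3 := mul_le_mul_of_nonneg_left h (exp_pos k).le
  have h4 : exp k * exp (-k) = 1 := by rw [← exp_add]; simp
  rw [mul_sub, mul_sub, ← mul_assoc, h4] at h3
  rw [← eq_sub_iff_add_eq] at h1 h2
  rw [h1, h2]
  linarith

lemma bsCall_of_pos {κ s : ℝ} (hκ : 0 < κ) (hs : 0 < s) :
    bsCall κ s =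
      stdNormalCDF (-log κ / s + s / 2) - κ * stdNormalCDF (-log κ / s - s / 2) := by
  rw [bsCall, if_neg hκ.ne', if_neg hs.ne']

lemma max_le_bsCall {κ s : ℝ} (hκ : 0 ≤ κ) (hs : 0 < s) : max (1 - κ) 0 ≤ bsCall κ s := by
  rcases hκ.eq_or_lt with rfl | hκ
  · simp [bsCall]
  · rw [bsCall_of_pos hκ hs]
    have h1 := one_sub_exp_le_blackScholes hs (log κ)
    have h2 := blackScholes_nonneg hs (log κ)
    rw [exp_log hκ] at h1 h2
    exact max_le h1 h2

lemma bsCall_le_one {κ s : ℝ} (hκ : 0 ≤ κ) (hs : 0 < s) : bsCall κ s ≤ 1 := by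
  rcases hκ.eq_or_lt with rfl | hκ
  · simp [bsCall]
  · rw [bsCall_of_pos hκ hs]
    have := mul_nonneg hκ.le (stdNormalCDF_nonneg (-log κ / s - s / 2))
    linarith [stdNormalCDF_le_one (-log κ / s + s / 2)]

/-! ### Convexity of the Call curve and Durrleman's condition. -/

/-- The derivative of the Call price curve in the strike, as a function of the log-strike. -/
noncomputable def callSlope (v v' : ℝ → ℝ) (k : ℝ) : ℝ :=
  -stdNormalCDF (-k / v k - v k / 2) + stdNormalPDF (-k / v k - v k / 2) * v' k

lemma hasDerivAt_callCurve {w v v' : ℝ → ℝ} (hw : ∀ k, √(w k) = v k) (hv : ∀ k, 0 < v k)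
    (hv' : ∀ k, HasDerivAt v (v' k) k) {κ : ℝ} (hκ : 0 < κ) :
    HasDerivAt (callCurve w) (callSlope v v' (log κ)) κ := by
  have he : callCurve w =ᶠ[𝓝 κ] fun κ => stdNormalCDF (-log κ / v (log κ) + v (log κ) / 2) -
      κ * stdNormalCDF (-log κ / v (log κ) - v (log κ) / 2) := by
    filter_upwards [lt_mem_nhds hκ] with x hx
    rw [callCurve, hw, bsCall_of_pos hx (hv _)]
  refine HasDerivAt.congr_of_eventuallyEq ?_ he
  have hl := hasDerivAt_log hκ.ne'
  have hvl := (hv' (log κ)).comp κ hl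
  have hq := hl.neg.div hvl (hv (log κ)).ne'
  have h := ((hasDerivAt_stdNormalCDF _).comp κ (hq.add (hvl.div_const 2))).sub
    ((hasDerivAt_id κ).mul ((hasDerivAt_stdNormalCDF _).comp κ (hq.sub (hvl.div_const 2))))
  refine h.congr_deriv ?_
  have hp := stdNormalPDF_add_half (hv (log κ)).ne' (log κ)
  rw [exp_log hκ] at hp
  simp only [Function.comp, Pi.neg_apply, Pi.add_apply, Pi.sub_apply, Pi.div_apply, id, hp, callSlope]
  have := (hv (log κ)).ne'
  have := hκ.ne'
  field_simp
  ring

lemma hasDerivAt_stdNormalPDF (x : ℝ) : HasDerivAt stdNormalPDF (-(x * stdNormalPDF x)) x := by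
  have h := ((((hasDerivAt_id x).pow 2).div_const 2).neg.exp).const_mul (√(2 * π))⁻¹
  refine h.congr_deriv ?_
  simp [stdNormalPDF]
  ring

/-- Durrleman's function, in terms of the total implied volatility `v`. -/
noncomputable def durrleman (v v' v'' : ℝ → ℝ) (k : ℝ) : ℝ :=
  (1 - k * v' k / v k) ^ 2 - (v k * v' k) ^ 2 / 4 + v k * v'' k

lemma hasDerivAt_callSlope {v v' v'' : ℝ → ℝ} (hv : ∀ k, 0 < v k)
    (hv' : ∀ k, HasDerivAt v (v' k) k) (hv'' : ∀ k, HasDerivAt v' (v'' k) k) (k : ℝ) :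
    HasDerivAt (callSlope v v')
      (stdNormalPDF (-k / v k - v k / 2) / v k * durrleman v v' v'' k) k := by
  have hd := ((hasDerivAt_neg k).div (hv' k) (hv k).ne').sub ((hv' k).div_const 2)
  have h := ((hasDerivAt_stdNormalCDF _).comp k hd).neg.add
    (((hasDerivAt_stdNormalPDF _).comp k hd).mul (hv'' k))
  refine h.congr_deriv ?_
  simp only [Function.comp, Pi.sub_apply, Pi.div_apply, durrleman]
  have := (hv k).ne'
  field_simp
  ring

theorem butterflyArbitrageFree_iff_durrleman_nonneg {w v v' v'' : ℝ → ℝ} (hw0 : ∀ k, 0 ≤ w k)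
    (hw : ∀ k, √(w k) = v k) (hv : ∀ k, 0 < v k)
    (hv' : ∀ k, HasDerivAt v (v' k) k) (hv'' : ∀ k, HasDerivAt v' (v'' k) k) :
    ButterflyArbitrageFree w ↔ ∀ k, 0 ≤ durrleman v v' v'' k := by
  have hC := fun κ hκ => hasDerivAt_callCurve hw hv hv' (κ := κ) hκ
  have hD := hasDerivAt_callSlope hv hv' hv''
  have lower : ∀ κ, 0 ≤ κ → max (1 - κ) 0 ≤ callCurve w κ := fun κ hκ => by
    rw [callCurve, hw]; exact max_le_bsCall hκ (hv _)
  have upper : ∀ κ, 0 ≤ κ → callCurve w κ ≤ 1 := fun κ hκ => by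
    rw [callCurve, hw]; exact bsCall_le_one hκ (hv _)
  constructor
  · intro h k
    have hc : ConvexOn ℝ (Ioi 0) (callCurve w) :=
      h.convex.subset Ioi_subset_Ici_self (convex_Ioi 0)
    have hm := hc.monotoneOn_deriv fun x hx => (hC x hx).differentiableAt
    have hmono : Monotone (callSlope v v') := fun k l hkl => by
      have := hm (exp_pos k) (exp_pos l) (exp_le_exp.2 hkl)
      rwa [(hC _ (exp_pos k)).deriv, (hC _ (exp_pos l)).deriv, log_exp, log_exp] at this
    have h0 : 0 ≤ deriv (callSlope v v') k := hmono.deriv_nonneg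
    rw [(hD k).deriv] at h0
    exact nonneg_of_mul_nonneg_right h0 (div_pos (stdNormalPDF_pos _) (hv k))
  · intro h
    refine ⟨hw0, ?_, lower, upper⟩
    have hmono : Monotone (callSlope v v') := monotone_of_hasDerivAt_nonneg hD fun k =>
      mul_nonneg (div_pos (stdNormalPDF_pos _) (hv k)).le (h k)
    refine MonotoneOn.convexOn_of_deriv (convex_Ici 0) ?_ ?_ ?_
    · intro κ hκ
      rcases (mem_Ici.1 hκ).eq_or_lt with rfl | hκ
      · have h0 : callCurve w 0 = 1 := by simp [callCurve, bsCall]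
        -- At zero strike, continuity follows by squeezing the price between 1 - κ and 1.
        rw [ContinuousWithinAt, h0]
        have ht : Tendsto (fun κ : ℝ => 1 - κ) (𝓝[Ici 0] 0) (𝓝 1) := by
          have : Continuous fun κ : ℝ => 1 - κ := by fun_prop
          simpa using (this.tendsto 0).mono_left nhdsWithin_le_nhds
        refine tendsto_of_tendsto_of_tendsto_of_le_of_le' ht tendsto_const_nhds ?_ ?_
        · filter_upwards [self_mem_nhdsWithin] with κ hκ
          exact (le_max_left _ _).trans (lower κ hκ)
        · filter_upwards [self_mem_nhdsWithin] with κ hκ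
          exact upper κ hκ
      · exact (hC κ hκ).continuousAt.continuousWithinAt
    · rw [interior_Ici]
      exact fun κ hκ => (hC κ hκ).differentiableAt.differentiableWithinAt
    · rw [interior_Ici]
      intro x hx y hy hxy
      rw [(hC x hx).deriv, (hC y hy).deriv]
      exact hmono (log_le_log hx hxy)

/-! ### Rational form of the condition for the Vanishing Upward SVI. -/

/-- The coefficient of `4 b / σ` in the no-arbitrage condition of the Vanishing Upward SVI, in the
variable `r = √(u ^ 2 + 1) - u`, where `u = (k - m) / σ`. -/
noncomputable def excess (r : ℝ) : ℝ := r * (1 - 3 * r ^ 2) / (1 + r ^ 2)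

theorem butterflyArbitrageFree_vanishingUpwardSVI_iff {b m σ : ℝ} (hb : 0 < b) (hσ : 0 < σ) :
    ButterflyArbitrageFree (vanishingUpwardSVI b m σ) ↔
      ∀ r : ℝ, 0 < r →
        b ^ 2 + 4 * b / σ * excess r ≤ (1 - 2 * (m / σ) * r + 3 * r ^ 2) ^ 2 := by
  let R : ℝ → ℝ := fun k => √((k - m) ^ 2 + σ ^ 2)
  let w := vanishingUpwardSVI b m σ
  let v : ℝ → ℝ := fun k => √(w k)
  have hR2 : ∀ k, R k ^ 2 = (k - m) ^ 2 + σ ^ 2 := fun k => sq_sqrt (by positivity)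
  have hR : ∀ k, 0 < R k := fun k => sqrt_pos.2 (by positivity)
  have hw : ∀ k, w k = b * (k - m + R k) := fun k => by
    simp only [w, R, vanishingUpwardSVI, svi]; ring
  have hdR : ∀ k, 0 < k - m + R k := fun k => by
    have : |k - m| < R k := lt_sqrt_of_sq_lt (by rw [sq_abs]; linarith [pow_pos hσ 2])
    linarith [(abs_lt.1 this).1, neg_abs_le (k - m)]
  have hw0 : ∀ k, 0 < w k := fun k => by rw [hw]; exact mul_pos hb (hdR k)
  have hv : ∀ k, 0 < v k := fun k => sqrt_pos.2 (hw0 k)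
  have hv2 : ∀ k, v k ^ 2 = w k := fun k => sq_sqrt (hw0 k).le
  have hR' : ∀ k, HasDerivAt R ((k - m) / R k) k := fun k => by
    have h0 : HasDerivAt (fun k => (k - m) ^ 2 + σ ^ 2) (2 * (k - m)) k :=
      ((((hasDerivAt_id' k).sub_const m).fun_pow 2).add_const (σ ^ 2)).congr_deriv (by ring)
    refine (h0.sqrt (by positivity)).congr_deriv ?_
    rw [mul_div_mul_left _ _ two_ne_zero]
  have hv' : ∀ k, HasDerivAt v (v k / (2 * R k)) k := fun k => by
    have h1 : HasDerivAt w (b * (1 + (k - m) / R k)) k := by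
      rw [funext hw]
      exact (((hasDerivAt_id k).sub_const m).add (hR' k)).const_mul b
    refine (h1.sqrt (hw0 k).ne').congr_deriv ?_
    have := (hR k).ne'
    have := (hv k).ne'
    change b * (1 + (k - m) / R k) / (2 * v k) = _
    field_simp
    rw [hv2, hw]
    ring
  have hv'' : ∀ k, HasDerivAt (fun k => v k / (2 * R k))
      (v k / (4 * R k ^ 2) - v k * (k - m) / (2 * R k ^ 3)) k := fun k => by
    have := (hR k).ne'
    refine ((hv' k).div ((hR' k).const_mul 2) (by positivity)).congr_deriv ?_
    field_simp
    ring
  rw [butterflyArbitrageFree_iff_durrleman_nonneg (fun k => (hw0 k).le) (fun _ => rfl) hv hv' hv'']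
  -- The hyperbola R² = (k - m)² + σ² is parametrized by k - m = σ(1 - r²)/(2r), R = σ(1 + r²)/(2r),
  -- whence v² = bσ/r.
  have key : ∀ k r, 0 < r → r * σ = R k - (k - m) →
      durrleman v (fun k => v k / (2 * R k))
        (fun k => v k / (4 * R k ^ 2) - v k * (k - m) / (2 * R k ^ 3)) k =
      ((1 - 2 * (m / σ) * r + 3 * r ^ 2) ^ 2 - (b ^ 2 + 4 * b / σ * excess r)) /
        (4 * (1 + r ^ 2) ^ 2) := fun k r hr h => by
    have e1 : R k = r * σ + (k - m) := by linarith
    have h2 := hR2 k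
    rw [e1] at h2
    have e2 : k = σ * (1 - r ^ 2) / (2 * r) + m := by
      field_simp
      have : σ * (σ * r ^ 2 + 2 * r * (k - m) - σ) = 0 := by linear_combination h2
      rcases mul_eq_zero.1 this with h | h
      · exact absurd h hσ.ne'
      · linear_combination h
    have e3 : R k = σ * (1 + r ^ 2) / (2 * r) := by
      rw [e1]
      nth_rw 1 [e2]
      field_simp
      ring
    have e4 : v k ^ 2 = b * (σ / r) := by
      rw [hv2, hw, e3]
      nth_rw 1 [e2]
      field_simp
      ring
    have hk0 := (hv k).ne'
    have e5 : durrleman v (fun k => v k / (2 * R k))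
        (fun k => v k / (4 * R k ^ 2) - v k * (k - m) / (2 * R k ^ 3)) k =
      (1 - k / (2 * R k)) ^ 2 - (v k ^ 2) ^ 2 / (16 * R k ^ 2) +
        v k ^ 2 * (1 / (4 * R k ^ 2) - (k - m) / (2 * R k ^ 3)) := by
      have := (hR k).ne'
      simp only [durrleman]
      field_simp
      ring
    rw [e5, e4, e3, excess]
    have e6 : k - m = σ * (1 - r ^ 2) / (2 * r) := by linarith
    rw [e6]
    nth_rw 1 [e2]
    have : (1 + r ^ 2) ≠ 0 := by positivity
    field_simp
    ring
  constructor
  · intro h r hr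
    let k := σ * (1 - r ^ 2) / (2 * r) + m
    have hk : r * σ = R k - (k - m) := by
      have : R k = σ * (1 + r ^ 2) / (2 * r) := by
        rw [← sqrt_sq (show 0 ≤ σ * (1 + r ^ 2) / (2 * r) by positivity)]
        simp only [R, k]
        congr 1
        field_simp
        ring
      rw [this]
      simp only [k]
      field_simp
      ring
    have h0 := h k
    rw [key k r hr hk] at h0
    rw [le_div_iff₀ (by positivity), zero_mul] at h0
    linarith
  · intro h k
    have hr : 0 < (R k - (k - m)) / σ := by
      refine div_pos ?_ hσ
      nlinarith [hR2 k, hdR k, pow_pos hσ 2]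
    rw [key k _ hr (div_mul_cancel₀ _ hσ.ne')]
    exact div_nonneg (by linarith [h _ hr]) (by positivity)

/-- `excess` is not concave on all of (0, ∞), but the gap to its tangent at s ≤ 1 is (r - s)² times
a nonnegative factor. -/
lemma excess_le_tangent {r s : ℝ} (hr : 0 < r) (hs : 0 < s) (hs1 : s ^ 2 ≤ 1) :
    excess r ≤ excess s + (1 - 10 * s ^ 2 - 3 * s ^ 4) / (1 + s ^ 2) ^ 2 * (r - s) := by
  have h : excess s + (1 - 10 * s ^ 2 - 3 * s ^ 4) / (1 + s ^ 2) ^ 2 * (r - s) - excess r =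
      4 * (r - s) ^ 2 * (r * (1 - s ^ 2) + 2 * s) / ((1 + s ^ 2) ^ 2 * (1 + r ^ 2)) := by
    unfold excess
    field_simp
    ring
  have : 0 ≤ 4 * (r - s) ^ 2 * (r * (1 - s ^ 2) + 2 * s) / ((1 + s ^ 2) ^ 2 * (1 + r ^ 2)) := by
    have := sub_nonneg.2 hs1
    positivity
  linarith

lemma excess_le_self {r : ℝ} (hr : 0 < r) : excess r ≤ r := by
  unfold excess
  rw [div_le_iff₀ (by positivity)]
  nlinarith [pow_pos hr 3]

lemma excess_pos {r : ℝ} (hr : 0 < r) (h : 3 * r ^ 2 < 1) : 0 < excess r := by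
  unfold excess
  have := sub_pos.2 h
  positivity

/-! ### The case b = 1. -/

theorem butterflyArbitrageFree_one_iff {m σ : ℝ} (hσ : 0 < σ) :
    ButterflyArbitrageFree (vanishingUpwardSVI 1 m σ) ↔
      m / σ < 0 ∧ -(1 / (m / σ)) ≤ σ := by
  rw [butterflyArbitrageFree_vanishingUpwardSVI_iff one_pos hσ]
  set μ := m / σ
  have hiff : (μ < 0 ∧ -(1 / μ) ≤ σ) ↔ 1 / σ ≤ -μ := by
    constructor
    · rintro ⟨h1, h2⟩
      rw [← one_div_neg_eq_neg_one_div] at h2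
      rwa [one_div_le hσ (by linarith)]
    · intro h
      have h1 : μ < 0 := by linarith [one_div_pos.2 hσ]
      refine ⟨h1, ?_⟩
      rwa [← one_div_neg_eq_neg_one_div, one_div_le (by linarith) hσ]
  rw [hiff]
  constructor
  · intro h
    -- The two sides minus 1, divided by r; their limits at 0⁺ are 4/σ and -4μ.
    let f : ℝ → ℝ := fun r => 4 / σ * ((1 - 3 * r ^ 2) / (1 + r ^ 2))
    let g : ℝ → ℝ := fun r => (-2 * μ + 3 * r) * (2 - 2 * μ * r + 3 * r ^ 2)
    have hf : ContinuousAt f 0 := by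
      refine ContinuousAt.mul continuousAt_const (ContinuousAt.div ?_ ?_ ?_)
      · fun_prop
      · fun_prop
      · norm_num
    have hg : ContinuousAt g 0 := by fun_prop
    have hle : f 0 ≤ g 0 := by
      refine le_of_tendsto_of_tendsto (hf.tendsto.mono_left nhdsWithin_le_nhds)
        (hg.tendsto.mono_left nhdsWithin_le_nhds) (b := 𝓝[>] (0 : ℝ)) ?_
      filter_upwards [self_mem_nhdsWithin] with r hr
      have hr : 0 < r := hr
      have h1 := h r hr
      have e : excess r = r * ((1 - 3 * r ^ 2) / (1 + r ^ 2)) := by unfold excess; ring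
      rw [e] at h1
      refine le_of_mul_le_mul_left ?_ hr
      simp only [f, g]
      linear_combination h1
    simp only [f, g] at hle
    norm_num at hle
    have : 4 / σ = 4 * (1 / σ) := by ring
    rw [one_div] at this ⊢
    linarith
  · intro h r hr
    have h1 : 1 / σ * excess r ≤ -μ * r :=
      (mul_le_mul_of_nonneg_left (excess_le_self hr) (one_div_pos.2 hσ).le).trans
        (mul_le_mul_of_nonneg_right h hr.le)
    have e : 4 * 1 / σ * excess r = 4 * (1 / σ * excess r) := by ring
    rw [e]
    nlinarith [sq_nonneg (-2 * μ * r + 3 * r ^ 2), sq_nonneg r]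

/-! ### The critical equation and the closed forms. -/

/-- The quadratic polynomial in `q = 1 - 2 μ r + 3 r ^ 2` whose vanishing expresses that
`r ↦ (q ^ 2 - b ^ 2) / excess r` is critical, with `z = r ^ 2`. -/
def criticalPoly (b z q : ℝ) : ℝ :=
  (1 + 6 * z - 3 * z ^ 2) * q ^ 2 - 2 * ((1 - 3 * z) ^ 2 * (1 + z)) * q
    + b ^ 2 * (1 - 10 * z - 3 * z ^ 2)

/-- Expansion around q = b: for 3z < 1 the remainder is negative exactly when 3z < 1 - b, the source
of the range of x. -/
lemma criticalPoly_eq (b z q : ℝ) :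
    criticalPoly b z q = (q - b) * ((1 + 6 * z - 3 * z ^ 2) * (q + b)
      - 2 * ((1 - 3 * z) ^ 2 * (1 + z))) + 2 * b * (1 - 3 * z) * (1 + z) * (b - (1 - 3 * z)) := by
  unfold criticalPoly; ring

/-- The larger root of `criticalPoly b z`. -/
noncomputable def criticalRoot (b z : ℝ) : ℝ :=
  ((1 - 3 * z) ^ 2 * (1 + z) + √(((1 - 3 * z) ^ 2 * (1 + z)) ^ 2
    - b ^ 2 * (1 + 6 * z - 3 * z ^ 2) * (1 - 10 * z - 3 * z ^ 2))) / (1 + 6 * z - 3 * z ^ 2)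

/-- The quadratic has positive leading coefficient and is negative at b, so b separates its two
roots. -/
lemma criticalPoly_eq_zero_and_lt_iff {b z q : ℝ} (hb : 0 < b) (hz : 0 ≤ z) (hzb : 3 * z < 1 - b) :
    criticalPoly b z q = 0 ∧ b < q ↔ q = criticalRoot b z := by
  have hα : 0 < 1 + 6 * z - 3 * z ^ 2 := by nlinarith
  have hEb : criticalPoly b z b < 0 := by
    rw [criticalPoly_eq]
    have h1 : 0 < 2 * b * (1 - 3 * z) * (1 + z) * (1 - 3 * z - b) := by
      have : 0 < 1 - 3 * z := by linarith
      have : 0 < 1 - 3 * z - b := by linarith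
      positivity
    linarith
  unfold criticalRoot
  set α := 1 + 6 * z - 3 * z ^ 2 with hαd
  set β := (1 - 3 * z) ^ 2 * (1 + z) with hβd
  set Δ := β ^ 2 - b ^ 2 * α * (1 - 10 * z - 3 * z ^ 2) with hΔd
  have hE : ∀ q, α * criticalPoly b z q = (α * q - β) ^ 2 - Δ := fun q => by
    rw [hΔd, criticalPoly, ← hαd, ← hβd]; ring
  have hlt : (α * b - β) ^ 2 < Δ := by
    have := hE b
    have := mul_neg_of_pos_of_neg hα hEb
    linarith
  have hS : |α * b - β| < √Δ := lt_sqrt_of_sq_lt (by rwa [sq_abs])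
  have hΔ : √Δ ^ 2 = Δ := sq_sqrt ((sq_nonneg _).trans hlt.le)
  obtain ⟨hS1, hS2⟩ := abs_lt.1 hS
  rw [eq_div_iff hα.ne']
  constructor
  · rintro ⟨h0, hq⟩
    have h1 := hE q
    rw [h0, mul_zero, ← hΔ] at h1
    have h2 : (α * q - β - √Δ) * (α * q - β + √Δ) = 0 := by linear_combination -h1
    have := mul_lt_mul_of_pos_left hq hα
    rcases mul_eq_zero.1 h2 with h | h <;> linarith
  · intro h
    constructor
    · have h1 := hE q
      rw [show α * q - β = √Δ by linarith, hΔ, sub_self] at h1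
      exact (mul_eq_zero.1 h1).resolve_left hα.ne'
    · refine lt_of_mul_lt_mul_left ?_ hα.le
      linarith

lemma sqrt_one_sub_sq {r : ℝ} (hr : 0 < r) :
    √(1 - ((1 - r ^ 2) / (1 + r ^ 2)) ^ 2) = 2 * r / (1 + r ^ 2) := by
  rw [← sqrt_sq (show 0 ≤ 2 * r / (1 + r ^ 2) by positivity)]
  congr 1
  field_simp
  ring

lemma muStar_eq {b r : ℝ} (hr : 0 < r) (hr1 : 3 * r ^ 2 < 1) :
    1 - 2 * muStar b ((1 - r ^ 2) / (1 + r ^ 2)) * r + 3 * r ^ 2 = criticalRoot b (r ^ 2) := by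
  unfold muStar criticalRoot
  rw [sqrt_one_sub_sq hr]
  set z := r ^ 2 with hz
  have hz0 : 0 < z := by positivity
  have hα : 0 < 1 + 6 * z - 3 * z ^ 2 := by nlinarith
  set Δ := ((1 - 3 * z) ^ 2 * (1 + z)) ^ 2
    - b ^ 2 * (1 + 6 * z - 3 * z ^ 2) * (1 - 10 * z - 3 * z ^ 2) with hΔ
  have hpoly : ∀ x, x = (1 - z) / (1 + z) →
      √(4 * b ^ 2 * x ^ 6 + 8 * b ^ 2 * x ^ 5 + 8 * x ^ 4 * (8 - b ^ 2)
          - 4 * x ^ 3 * (5 * b ^ 2 + 32) + x ^ 2 * (96 - b ^ 2)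
          + 2 * x * (5 * b ^ 2 - 16) + 4 + 3 * b ^ 2) = 2 / (1 + z) ^ 3 * √Δ := by
    rintro x rfl
    rw [← sqrt_sq (show 0 ≤ 2 / (1 + z) ^ 3 by positivity), ← sqrt_mul (by positivity)]
    congr 1
    rw [hΔ]
    field_simp
    ring
  rw [hpoly _ rfl]
  have hden : 2 * ((1 - z) / (1 + z)) ^ 2 - 2 * ((1 - z) / (1 + z)) - 1 =
      -((1 + 6 * z - 3 * z ^ 2) / (1 + z) ^ 2) := by
    field_simp
    ring
  rw [hden]
  generalize hαd : 1 + 6 * z - 3 * z ^ 2 = α at hα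
  have hα' := hα.ne'
  field_simp
  rw [← hαd]
  ring

lemma sigmaStar_eq {b r : ℝ} (hr : 0 < r) :
    sigmaStar b ((1 - r ^ 2) / (1 + r ^ 2)) = 4 * b * excess r /
      ((1 - 2 * muStar b ((1 - r ^ 2) / (1 + r ^ 2)) * r + 3 * r ^ 2) ^ 2 - b ^ 2) := by
  unfold sigmaStar excess
  rw [sqrt_one_sub_sq hr]
  generalize muStar b ((1 - r ^ 2) / (1 + r ^ 2)) = μ
  have e : 4 * (2 - (1 - r ^ 2) / (1 + r ^ 2) - μ * (2 * r / (1 + r ^ 2))) ^ 2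
      - b ^ 2 * (1 + (1 - r ^ 2) / (1 + r ^ 2)) ^ 2 =
      4 / (1 + r ^ 2) ^ 2 * ((1 - 2 * μ * r + 3 * r ^ 2) ^ 2 - b ^ 2) := by
    field_simp
    ring
  rw [e]
  generalize (1 - 2 * μ * r + 3 * r ^ 2) ^ 2 - b ^ 2 = D
  have : (1 + r ^ 2) ≠ 0 := by positivity
  rw [← div_div, ← neg_div]
  congr 1
  field_simp
  ring

/-! ### The case 0 < b < 1. -/

lemma le_sq_of_critical {b c μ r₀ r : ℝ} (hb : 0 < b) (hr₀ : 0 < r₀) (h3 : 3 * r₀ ^ 2 < 1)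
    (hr : 0 < r) (hq : b < 1 - 2 * μ * r₀ + 3 * r₀ ^ 2)
    (hE : criticalPoly b (r₀ ^ 2) (1 - 2 * μ * r₀ + 3 * r₀ ^ 2) = 0)
    (hc : c * excess r₀ = (1 - 2 * μ * r₀ + 3 * r₀ ^ 2) ^ 2 - b ^ 2) :
    b ^ 2 + c * excess r ≤ (1 - 2 * μ * r + 3 * r ^ 2) ^ 2 := by
  have hψ := excess_pos hr₀ h3
  set q₀ := 1 - 2 * μ * r₀ + 3 * r₀ ^ 2 with hq₀
  have hc0 : 0 < c := by
    refine pos_of_mul_pos_left ?_ hψ.le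
    rw [hc]; nlinarith
  set p := (1 - 10 * r₀ ^ 2 - 3 * r₀ ^ 4) / (1 + r₀ ^ 2) ^ 2 with hp
  -- Criticality says that c · excess and q² have the same slope at r₀.
  have hcp : c * p = 2 * q₀ * (6 * r₀ - 2 * μ) := by
    have h1 : c * (r₀ * (1 - 3 * r₀ ^ 2)) = (q₀ ^ 2 - b ^ 2) * (1 + r₀ ^ 2) := by
      rw [← hc, excess]; field_simp
    have hn : r₀ * (1 - 3 * r₀ ^ 2) ≠ 0 := by
      have := sub_pos.2 h3
      positivity
    rw [hp]
    have hμ : 2 * μ * r₀ = 1 + 3 * r₀ ^ 2 - q₀ := by rw [hq₀]; ring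
    field_simp
    refine mul_left_cancel₀ hn ?_
    unfold criticalPoly at hE
    linear_combination (1 - 10 * r₀ ^ 2 - 3 * r₀ ^ 4) * h1 - (1 + r₀ ^ 2) * hE
      + 2 * q₀ * (1 - 3 * r₀ ^ 2) * (1 + r₀ ^ 2) ^ 2 * hμ
  have ht := mul_le_mul_of_nonneg_left
    (excess_le_tangent hr hr₀ (by linarith [sq_nonneg r₀])) hc0.le
  have hqr : 1 - 2 * μ * r + 3 * r ^ 2 = q₀ + (6 * r₀ - 2 * μ) * (r - r₀) + 3 * (r - r₀) ^ 2 := by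
    rw [hq₀]; ring
  have hle : b ^ 2 + c * excess r ≤ q₀ ^ 2 + 2 * q₀ * ((6 * r₀ - 2 * μ) * (r - r₀)) := by
    rw [mul_add, hc, ← mul_assoc, hcp] at ht
    linarith
  rw [hqr]
  set d := (6 * r₀ - 2 * μ) * (r - r₀)
  have hs := sq_nonneg (r - r₀)
  -- The tangent value q₀² + 2q₀d is at most (q₀ + d)², and is negative when q₀ + d < 0.
  rcases le_or_gt 0 (q₀ + d) with h | h
  · nlinarith [sq_nonneg d, mul_nonneg h hs]
  · nlinarith [sq_nonneg (q₀ + d + 3 * (r - r₀) ^ 2)]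

lemma lt_of_sq_lt_sq_of_pos {b μ : ℝ} (hb1 : b < 1)
    (h : ∀ r : ℝ, 0 < r → 3 * r ^ 2 < 1 → b ^ 2 < (1 - 2 * μ * r + 3 * r ^ 2) ^ 2)
    {r : ℝ} (hr : 0 < r) (h3 : 3 * r ^ 2 < 1) : b < 1 - 2 * μ * r + 3 * r ^ 2 := by
  by_contra! hlt
  have hc : ContinuousOn (fun r : ℝ => 1 - 2 * μ * r + 3 * r ^ 2) (Icc 0 r) := by fun_prop
  obtain ⟨s, ⟨hs0, hsr⟩, hs⟩ := intermediate_value_Icc' hr.le hc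
    (show b ∈ _ from ⟨hlt, by norm_num; exact hb1.le⟩)
  simp only at hs
  rcases hs0.eq_or_lt with rfl | hs0
  · norm_num at hs; linarith
  · have := h s hs0 (by nlinarith)
    rw [hs] at this
    exact lt_irrefl _ this

/-- For 0 < μ < √3 the minimizer μ/3 of q lies in the range of the hypothesis. This handles the
region where `excess` is negative. -/
lemma le_of_forall_lt_of_three_mul_sq_lt {b μ : ℝ} (hb : 0 < b) (hb1 : b < 1)
    (h : ∀ r : ℝ, 0 < r → 3 * r ^ 2 < 1 → b < 1 - 2 * μ * r + 3 * r ^ 2)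
    {r : ℝ} (hr : 0 < r) : b ≤ 1 - 2 * μ * r + 3 * r ^ 2 := by
  rcases le_or_gt μ 0 with hμ | hμ
  · nlinarith [mul_nonneg (neg_nonneg.2 hμ) hr.le]
  have h3 : √3 ^ 2 = 3 := sq_sqrt (by norm_num)
  have h30 : 0 < √3 := by positivity
  have hμ3 : μ < √3 := by
    by_contra! hge
    -- At this point μ ≥ √3 would force q ≤ 1 - 2(1 - b) + (1 - b)² = b² < b.
    have hs0 : 0 < (1 - b) / √3 := div_pos (by linarith) h30
    have hs : √3 * ((1 - b) / √3) = 1 - b := by field_simp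
    have hs2 : 3 * ((1 - b) / √3) ^ 2 = (1 - b) ^ 2 := by rw [← hs, mul_pow, h3, hs]
    have h1 := h _ hs0 (by rw [hs2]; nlinarith)
    rw [hs2] at h1
    have := mul_le_mul_of_nonneg_right hge hs0.le
    rw [hs] at this
    nlinarith
  have h1 := h (μ / 3) (by positivity) (by nlinarith)
  nlinarith [sq_nonneg (r - μ / 3)]

theorem forall_le_sq_iff_exists_critical {b c μ : ℝ} (hb : 0 < b) (hb1 : b < 1) (hc : 0 < c) :
    (∀ r : ℝ, 0 < r → b ^ 2 + c * excess r ≤ (1 - 2 * μ * r + 3 * r ^ 2) ^ 2) ↔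
      ∃ r : ℝ, 0 < r ∧ 3 * r ^ 2 < 1 - b ∧
        1 - 2 * μ * r + 3 * r ^ 2 = criticalRoot b (r ^ 2) ∧
        c * excess r ≤ (1 - 2 * μ * r + 3 * r ^ 2) ^ 2 - b ^ 2 := by
  constructor
  · intro h
    have hq : ∀ r : ℝ, 0 < r → 3 * r ^ 2 < 1 → b < 1 - 2 * μ * r + 3 * r ^ 2 := fun r hr h3 =>
      lt_of_sq_lt_sq_of_pos hb1 (fun s hs hs3 => by
        have := h s hs
        have := mul_pos hc (excess_pos hs hs3)
        linarith) hr h3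
    -- At ρ the remainder in `criticalPoly_eq` vanishes, so the critical polynomial is positive
    -- there; at 0 it is b² - 1 < 0.
    let ρ := √((1 - b) / 3)
    have hρ : 0 < ρ := sqrt_pos.2 (by linarith)
    have hρ2 : 3 * ρ ^ 2 = 1 - b := by
      simp only [ρ]; rw [sq_sqrt (by linarith)]; ring
    let E : ℝ → ℝ := fun r => criticalPoly b (r ^ 2) (1 - 2 * μ * r + 3 * r ^ 2)
    have hEc : ContinuousOn E (Icc 0 ρ) := by
      simp only [E, criticalPoly]; fun_prop
    have hE0 : E 0 < 0 := by
      have : E 0 = b ^ 2 - 1 := by simp only [E, criticalPoly]; ring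
      rw [this]; nlinarith
    have hE1 : 0 < E ρ := by
      have hqρ := hq ρ hρ (by linarith)
      simp only [E]
      rw [criticalPoly_eq]
      generalize 1 - 2 * μ * ρ + 3 * ρ ^ 2 = q at hqρ
      have hz : 0 < ρ ^ 2 := by positivity
      have hbz : b = 1 - 3 * ρ ^ 2 := by linarith
      generalize ρ ^ 2 = z at hz hbz
      subst hbz
      have h2 : 0 < (1 + 6 * z - 3 * z ^ 2) * (q + (1 - 3 * z))
          - 2 * ((1 - 3 * z) ^ 2 * (1 + z)) := by
        have : 0 < 1 + 6 * z - 3 * z ^ 2 := by nlinarith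
        nlinarith [mul_lt_mul_of_pos_left hqρ this, mul_pos hb hz]
      have := mul_pos (sub_pos.2 hqρ) h2
      linarith
    obtain ⟨r, ⟨hr0, hrρ⟩, hr⟩ := intermediate_value_Ioo hρ.le hEc ⟨hE0, hE1⟩
    have hr3 : 3 * r ^ 2 < 1 - b := by nlinarith
    exact ⟨r, hr0, hr3, (criticalPoly_eq_zero_and_lt_iff hb (sq_nonneg r) hr3).1
      ⟨hr, hq r hr0 (by linarith)⟩, by linarith [h r hr0]⟩
  · rintro ⟨s, hs, hsb, hcrit, hle⟩ r hr
    obtain ⟨hE, hq⟩ := (criticalPoly_eq_zero_and_lt_iff hb (sq_nonneg s) hsb).2 hcrit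
    have hs3 : 3 * s ^ 2 < 1 := by linarith
    have hψ := excess_pos hs hs3
    set C := ((1 - 2 * μ * s + 3 * s ^ 2) ^ 2 - b ^ 2) / excess s with hC
    have hcC : c ≤ C := (le_div_iff₀ hψ).2 hle
    have hmax : ∀ r : ℝ, 0 < r → b ^ 2 + C * excess r ≤ (1 - 2 * μ * r + 3 * r ^ 2) ^ 2 :=
      fun r hr => le_sq_of_critical hb hs hs3 hr hq hE (div_mul_cancel₀ _ hψ.ne')
    rcases le_or_gt 0 (excess r) with h0 | h0
    -- C is the largest admissible coefficient; lowering it to c helps only where `excess` is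
    -- nonnegative. Elsewhere q ≥ b suffices.
    · linarith [hmax r hr, mul_le_mul_of_nonneg_right hcC h0]
    · have hbr := le_of_forall_lt_of_three_mul_sq_lt (μ := μ) hb hb1 (fun r hr h3 =>
        lt_of_sq_lt_sq_of_pos hb1 (fun s hs hs3 => by
          have := hmax s hs
          have := mul_pos (hc.trans_le hcC) (excess_pos hs hs3)
          linarith) hr h3) hr
      nlinarith [mul_neg_of_pos_of_neg hc h0]

/-! ### Return to the parameters x, μ* and σ*. -/

lemma vanishingUpwardSVI_eq_iff {b m σ ν : ℝ} (hb : 0 < b) (hσ : 0 < σ) :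
    (∀ k : ℝ, vanishingUpwardSVI b m σ k =
      b * σ * (k / σ - ν + √((k / σ - ν) ^ 2 + 1))) ↔ m / σ = ν := by
  constructor
  · intro h
    -- At k = m, with t = m/σ - ν, equality reads √(t² + 1) = 1 - t, which forces t = 0.
    have h0 := h m
    simp only [vanishingUpwardSVI, svi, sub_self] at h0
    have e : √(0 ^ 2 + σ ^ 2) = σ := by simp [sqrt_sq hσ.le]
    rw [e] at h0
    have h1 : √((m / σ - ν) ^ 2 + 1) = 1 - (m / σ - ν) := by
      have : b * σ * 1 = b * σ * (m / σ - ν + √((m / σ - ν) ^ 2 + 1)) := by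
        linear_combination h0
      linarith [mul_left_cancel₀ (mul_pos hb hσ).ne' this]
    have h2 : √((m / σ - ν) ^ 2 + 1) ^ 2 = (m / σ - ν) ^ 2 + 1 := sq_sqrt (by positivity)
    rw [h1] at h2
    linarith
  · rintro rfl k
    have e : √((k - m) ^ 2 + σ ^ 2) = σ * √((k / σ - m / σ) ^ 2 + 1) := by
      rw [← sub_div, ← sqrt_sq hσ.le, ← sqrt_mul (by positivity), sqrt_sq hσ.le]
      congr 1
      field_simp
    rw [vanishingUpwardSVI, svi, e]
    field_simp
    ring

lemma exists_sqrt_param {b : ℝ} (hb : 0 < b) (hb1 : b < 1) (p : ℝ → Prop) :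
    (∃ x : ℝ, (2 + b) / (4 - b) < x ∧ x < 1 ∧ p x) ↔
      ∃ r : ℝ, 0 < r ∧ 3 * r ^ 2 < 1 - b ∧ p ((1 - r ^ 2) / (1 + r ^ 2)) := by
  constructor
  · rintro ⟨x, hx0, hx1, hp⟩
    rw [div_lt_iff₀ (by linarith)] at hx0
    have hx : 0 < 1 + x := by nlinarith
    have hd : 0 < (1 - x) / (1 + x) := div_pos (by linarith) hx
    have hr2 : √((1 - x) / (1 + x)) ^ 2 = (1 - x) / (1 + x) := sq_sqrt hd.le
    refine ⟨√((1 - x) / (1 + x)), sqrt_pos.2 hd, ?_, ?_⟩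
    · rw [hr2, ← mul_div_assoc, div_lt_iff₀ hx]
      linarith
    · rw [hr2]
      convert hp using 1
      field_simp
      ring
  · rintro ⟨r, hr, hr3, hp⟩
    have hz : 0 < r ^ 2 := by positivity
    refine ⟨_, ?_, ?_, hp⟩
    · rw [div_lt_div_iff₀ (by linarith) (by positivity)]
      linarith
    · rw [div_lt_one (by positivity)]
      linarith

theorem butterflyArbitrageFree_iff_exists {b m σ : ℝ} (hb : 0 < b) (hb1 : b < 1) (hσ : 0 < σ) :
    ButterflyArbitrageFree (vanishingUpwardSVI b m σ) ↔
      ∃ x : ℝ, (2 + b) / (4 - b) < x ∧ x < 1 ∧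
        (∀ k : ℝ, vanishingUpwardSVI b m σ k =
          b * σ * (k / σ - muStar b x + √((k / σ - muStar b x) ^ 2 + 1))) ∧
        sigmaStar b x ≤ σ := by
  rw [butterflyArbitrageFree_vanishingUpwardSVI_iff hb hσ,
    forall_le_sq_iff_exists_critical hb hb1 (by positivity), exists_sqrt_param hb hb1]
  refine exists_congr fun r => and_congr_right fun hr => and_congr_right fun hr3 => ?_
  have hr1 : 3 * r ^ 2 < 1 := by linarith
  rw [vanishingUpwardSVI_eq_iff hb hσ, sigmaStar_eq hr, ← muStar_eq hr hr1]
  have hiff : 1 - 2 * (m / σ) * r + 3 * r ^ 2 =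
      1 - 2 * muStar b ((1 - r ^ 2) / (1 + r ^ 2)) * r + 3 * r ^ 2 ↔
      m / σ = muStar b ((1 - r ^ 2) / (1 + r ^ 2)) := by
    constructor
    · intro h
      exact mul_right_cancel₀ hr.ne' (by linarith)
    · rintro h
      rw [h]
  rw [hiff]
  refine and_congr_right fun hμ => ?_
  have hq : b < 1 - 2 * (m / σ) * r + 3 * r ^ 2 := by
    have := muStar_eq (b := b) hr hr1
    rw [← hμ] at this
    exact ((criticalPoly_eq_zero_and_lt_iff hb (sq_nonneg r) hr3).2 this).2
  rw [← hμ, div_le_iff₀ (by nlinarith), div_mul_eq_mul_div, div_le_iff₀ hσ,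
    mul_comm _ σ]

end SVI

theorem mainTheorem1 :
    (∀ m σ μ : ℝ, 0 < σ → μ = m / σ →
      (SVI.ButterflyArbitrageFree (SVI.vanishingUpwardSVI 1 m σ) ↔ μ < 0 ∧ -(1 / μ) ≤ σ)) ∧
    (∀ b m σ : ℝ, 0 < b → b < 1 → 0 < σ →
      (SVI.ButterflyArbitrageFree (SVI.vanishingUpwardSVI b m σ) ↔
        ∃ x : ℝ, (2 + b) / (4 - b) < x ∧ x < 1 ∧
          (∀ k : ℝ, SVI.vanishingUpwardSVI b m σ k =
            b * σ * (k / σ - SVI.muStar b x + √((k / σ - SVI.muStar b x) ^ 2 + 1))) ∧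
          SVI.sigmaStar b x ≤ σ)) := by
  refine ⟨?_, fun b m σ hb hb1 hσ => SVI.butterflyArbitrageFree_iff_exists hb hb1 hσ⟩
  rintro m σ _ hσ rfl
  exact SVI.butterflyArbitrageFree_one_iff hσ
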